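/- Work in $\Lambda$-theory. Let $\mathbb U$ be a universe containing all functions $\mathbb R\to\mathbb C$ (for instance the superstructure over $\mathbb R$), let $\mathcal F$ be the family of its finite subsets, and let $\mathbb R^{*}$ be a superreal field (an ordered field properly extending $\mathbb R$) with a $\Lambda$-limit, i.e. a map $\varphi\mapsto\lim_{\lambda\uparrow\mathbb U}\varphi(\lambda)$ from the nets $\varphi:\mathcal F\to\mathbb R$ onto $\mathbb R^{*}$ that is compatible with sums and products and sends every net that is eventually constant, with value $r$, to $r$. Put $\mathbb C^{*}=\mathbb R^{*}+i\,\mathbb R^{*}$ and take $\Lambda$-limits of complex nets componentwise. The $\Lambda$-limit of a net of functions $f_\lambda:\mathbb R\to\mathbb C$ is the function $\mathbb R^{*}\to\mathbb C^{*}$ given by $(\lim f_\lambda)(\lim x_\lambda)=\lim f_\lambda(x_\lambda)$; the $\Lambda$-limit of a net of sets $S_\lambda$ of functions is the set of all $\lim f_\lambda$ with $f_\lambda\in S_\lambda$ for all $\lambda$; and ${}^{*}$ denotes natural extension (the limit of a constant net). In particular $\int^{*}\lim f_\lambda=\lim\int f_\lambda$ for integrable $f_\lambda$, and $e^{it}$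 for $t\in\mathbb R^{*}$ is the natural extension of $t\mapsto e^{it}$. Let $V=V^{\mathfrak F}(\mathbb R)=H^1(\mathbb R)\cap L^2(\mathbb R,|x|^2)$, a complex vector space of continuous functions $\mathbb R\to\mathbb C$, and let $\widetilde V=\lim_{\lambda\uparrow\mathbb U}\operatorname{Span}(V\cap\lambda)$ be the space of ultrafunctions generated by $V$. Assume the Fourier transform axiom: if $u\in\widetilde V$, then $\overline u\in\widetilde V$ and $\mathfrak F^{*}(u)\in\widetilde V$, where $\mathfrak F^{*}(u)(k)=\frac1{\sqrt{2\pi}}\int^{*}u(x)e^{-ikx}\,dx$. Let $\mathfrak D$ be the set of measurable functions $f$ such that $fv$ is integrable for all $v\in V$. A canonical extension of $u\in\mathfrak D^{*}$ is an ultrafunction $\widetilde u\in\widetilde V$ such that $\int^{*}u\,v=\int^{*}\widetilde u\,v$ for every $v\in\widetilde V$. Then for every $k\in\mathbb R^{*}$ the function $x\mapsto e^{ikx}$ belongs to $\mathfrak D^{*}$ and has exactly one canonical extension, $x\mapsto\widetilde{e^{ikx}}$; for every $x\in\mathbb R^{*}$ the function $k\mapsto e^{ixk}$ belongs to $\mathfrak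 D^{*}$ and has exactly one canonical extension, $k\mapsto\widetilde{e^{ixk}}$; and $$\widetilde{e^{ikx}}=\widetilde{e^{ixk}}\qquad\text{for all }k,x\in\mathbb R^{*},$$ where on the left $e^{ikx}$ is extended as a function of $x$ ($k$ fixed) and evaluated at $x$, and on the right $e^{ixk}$ is extended as a function of $k$ ($x$ fixed) and evaluated at $k$. -/

import Mathlib

open MeasureTheory
open scoped ContDiff

/-! ### The `Λ`-limit

`𝕌` is the mathematical universe, `Finset 𝕌` the directed family of its finite subsets, and a net is
a function on `Finset 𝕌`. -/

/-- A `Λ`-limit on the universe `𝕌` with values in the ordered field `K ⊇ ℝ`, i.e. the axioms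
(existence, real numbers, sum and product) of `Λ`-theory. -/
structure LambdaLimit (𝕌 K : Type*) [Field K] [LinearOrder K] [IsStrictOrderedRing K]
    [Algebra ℝ K] where
  /-- the `Λ`-limit of a real net -/
  lim : (Finset 𝕌 → ℝ) → K
  /-- `K` is a superreal field: it extends `ℝ` properly -/
  superreal : ¬ Function.Surjective (algebraMap ℝ K)
  /-- every element of `K` is the limit of a real net -/
  surj : Function.Surjective lim
  /-- an eventually constant net converges to its eventual value -/
  lim_of_eventually_const : ∀ (φ : Finset 𝕌 → ℝ) (l₀ : Finset 𝕌) (r : ℝ),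
    (∀ l, l₀ ⊆ l → φ l = r) → lim φ = algebraMap ℝ K r
  lim_add : ∀ φ ψ : Finset 𝕌 → ℝ, lim φ + lim ψ = lim (fun l => φ l + ψ l)
  lim_mul : ∀ φ ψ : Finset 𝕌 → ℝ, lim φ * lim ψ = lim (fun l => φ l * ψ l)

/-- `ℂ^*`: the numbers `a + b i` with `a, b ∈ K = ℝ^*` and `i² = -1`. -/
abbrev HyperComplex (K : Type*) [Field K] : Type _ := QuadraticAlgebra K (-1) 0

namespace LambdaLimit

variable {𝕌 K : Type*} [Field K] [LinearOrder K] [IsStrictOrderedRing K] [Algebra ℝ K]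
  (L : LambdaLimit 𝕌 K)

/-- The `Λ`-limit of a net of complex numbers. -/
def limC (φ : Finset 𝕌 → ℂ) : HyperComplex K :=
  ⟨L.lim fun l => (φ l).re, L.lim fun l => (φ l).im⟩

/-- A net of real numbers with limit `x`. -/
noncomputable def net (x : K) : Finset 𝕌 → ℝ := (L.surj x).choose

/-- The `Λ`-limit of a net of functions `ℝ → ℂ`; it is characterised (see `limFun_lim`) by
`(lim f_l) (lim x_l) = lim (f_l x_l)` for all nets `x_l`, i.e. its graph is the `Λ`-limit of the
graphs. -/
noncomputable def limFun (f : Finset 𝕌 → ℝ → ℂ) (x : K) : HyperComplex K :=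
  L.limC fun l => f l (L.net x l)

/-- The natural extension `f^*` of a function `f : ℝ → ℂ`. -/
noncomputable def starFun (f : ℝ → ℂ) : K → HyperComplex K := L.limFun fun _ => f

/-- The `Λ`-limit of a net of sets of functions. -/
def limSet (S : Finset 𝕌 → Set (ℝ → ℂ)) : Set (K → HyperComplex K) :=
  {w | ∃ f : Finset 𝕌 → ℝ → ℂ, (∀ l, f l ∈ S l) ∧ L.limFun f = w}

/-- The natural extension `S^*` of a set `S` of functions `ℝ → ℂ`. -/
def starSet (S : Set (ℝ → ℂ)) : Set (K → HyperComplex K) := L.limSet fun _ => S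

open Classical in
/-- `∫^*`, the natural extension of the Lebesgue integral `∫ : L¹(ℝ) → ℂ`: for integrable `f_l`,
`∫^* (lim f_l) = lim ∫ f_l` (see `starIntegral_limFun`). Outside `L¹(ℝ)^*` the value is `0`. -/
noncomputable def starIntegral (w : K → HyperComplex K) : HyperComplex K :=
  if h : w ∈ L.starSet {f | Integrable f} then L.limC fun l => ∫ x, h.choose l x else 0

section wellDefined

theorem lim_zero : L.lim (fun _ => 0) = 0 := by
  simpa using L.lim_of_eventually_const (fun _ => 0) ∅ 0 (fun _ _ => rfl)

theorem lim_sub (φ ψ : Finset 𝕌 → ℝ) : L.lim (fun l => φ l - ψ l) = L.lim φ - L.lim ψ := by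
  rw [eq_sub_iff_add_eq, L.lim_add]
  simp

theorem lim_net (x : K) : L.lim (L.net x) = x := (L.surj x).choose_spec

/-- If `lim d = 0`, then two nets that agree wherever `d` vanishes have the same limit. -/
theorem lim_congr_of_zero {d a b : Finset 𝕌 → ℝ} (hd : L.lim d = 0)
    (h : ∀ l, d l = 0 → a l = b l) : L.lim a = L.lim b := by
  rw [← sub_eq_zero, ← L.lim_sub]
  have : (fun l => a l - b l) = fun l => d l * ((a l - b l) / d l) := by
    funext l
    by_cases hl : d l = 0
    · simp [hl, h l hl]
    · field_simp
  rw [this, ← L.lim_mul, hd, zero_mul]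

theorem limC_congr_of_zero {d : Finset 𝕌 → ℝ} {a b : Finset 𝕌 → ℂ} (hd : L.lim d = 0)
    (h : ∀ l, d l = 0 → a l = b l) : L.limC a = L.limC b := by
  unfold limC
  rw [L.lim_congr_of_zero hd (a := fun l => (a l).re) fun l hl => by rw [h l hl],
    L.lim_congr_of_zero hd (a := fun l => (a l).im) fun l hl => by rw [h l hl]]

theorem limFun_lim (f : Finset 𝕌 → ℝ → ℂ) (x : Finset 𝕌 → ℝ) :
    L.limFun f (L.lim x) = L.limC fun l => f l (x l) := by
  refine L.limC_congr_of_zero (d := fun l => L.net (L.lim x) l - x l) ?_ ?_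
  · rw [L.lim_sub, L.lim_net, sub_self]
  · intro l hl
    rw [sub_eq_zero.1 hl]

theorem exists_zero_of_limFun_eq {f g : Finset 𝕌 → ℝ → ℂ} (h : L.limFun f = L.limFun g) :
    ∃ d : Finset 𝕌 → ℝ, L.lim d = 0 ∧ ∀ l, d l = 0 → f l = g l := by
  classical
  have hx : ∀ l, ∃ x : ℝ, f l x = g l x → f l = g l := by
    intro l
    by_contra! hc
    exact (hc 0).2 (funext fun x => (hc x).1)
  choose x hx using hx
  have h1 := congrFun h (L.lim x)
  rw [L.limFun_lim, L.limFun_lim] at h1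
  have hre := congrArg QuadraticAlgebra.re h1
  have him := congrArg QuadraticAlgebra.im h1
  simp only [limC] at hre him
  refine ⟨fun l => ((f l (x l)).re - (g l (x l)).re) * ((f l (x l)).re - (g l (x l)).re)
      + ((f l (x l)).im - (g l (x l)).im) * ((f l (x l)).im - (g l (x l)).im), ?_, ?_⟩
  · rw [← L.lim_add, ← L.lim_mul, ← L.lim_mul, L.lim_sub, L.lim_sub, hre, him]
    simp
  · intro l hl
    have h2 := (add_eq_zero_iff_of_nonneg (mul_self_nonneg _) (mul_self_nonneg _)).1 hl
    exact hx l (Complex.ext (sub_eq_zero.1 (mul_self_eq_zero.1 h2.1))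
      (sub_eq_zero.1 (mul_self_eq_zero.1 h2.2)))

theorem starIntegral_limFun (f : Finset 𝕌 → ℝ → ℂ) (hf : ∀ l, Integrable (f l)) :
    L.starIntegral (L.limFun f) = L.limC fun l => ∫ x, f l x := by
  have h : L.limFun f ∈ L.starSet {f | Integrable f} := ⟨f, hf, rfl⟩
  unfold starIntegral
  rw [dif_pos h]
  obtain ⟨d, hd, hd'⟩ := L.exists_zero_of_limFun_eq h.choose_spec.2
  exact L.limC_congr_of_zero hd fun l hl => by rw [hd' l hl]

end wellDefined

/-- The space of ultrafunctions `Ṽ = lim V_l`, `V_l = Span (V ∩ l)`, generated by `V`. The injection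
`ι` exhibits the functions `ℝ → ℂ` as elements of the universe. -/
def ultrafunctions (ι : (ℝ → ℂ) ↪ 𝕌) (V : Submodule ℂ (ℝ → ℂ)) : Set (K → HyperComplex K) :=
  L.limSet fun l => (Submodule.span ℂ {v | v ∈ V ∧ ι v ∈ l} : Submodule ℂ (ℝ → ℂ))

/-- `V' ∩ 𝔐`: the (Lebesgue) measurable functions `f` that define a functional `v ↦ ∫ f v` on `V`. -/
def dualMeasurable (V : Submodule ℂ (ℝ → ℂ)) : Set (ℝ → ℂ) :=
  {f | AEMeasurable f ∧ ∀ v ∈ V, Integrable fun x => f x * v x}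

/-- `w = ũ`: the function `u` is in `[V' ∩ 𝔐]^*`, `w` is an ultrafunction, and
`∫^* u v = ∫^* w v` for every ultrafunction `v`. -/
def IsCanonicalExtension (ι : (ℝ → ℂ) ↪ 𝕌) (V : Submodule ℂ (ℝ → ℂ))
    (u w : K → HyperComplex K) : Prop :=
  u ∈ L.starSet (dualMeasurable V) ∧ w ∈ L.ultrafunctions ι V ∧
    ∀ v ∈ L.ultrafunctions ι V,
      L.starIntegral (fun x => u x * v x) = L.starIntegral (fun x => w x * v x)

open Classical in
/-- The canonical extension `ũ` of `u` (`0` if there is none). -/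
noncomputable def canonicalExtension (ι : (ℝ → ℂ) ↪ 𝕌) (V : Submodule ℂ (ℝ → ℂ))
    (u : K → HyperComplex K) : K → HyperComplex K :=
  if h : ∃ w, L.IsCanonicalExtension ι V u w then h.choose else 0

/-- `t ↦ e^{it}` on `ℝ^*`, the natural extension of `t ↦ e^{it}` on `ℝ`. -/
noncomputable def expI : K → HyperComplex K :=
  L.starFun fun t => Complex.exp (Complex.I * t)

/-- The Fourier transform `𝔉^*(u)(k) = (2π)^{-1/2} ∫^* u(x) e^{-ikx} dx`. -/
noncomputable def starFourier (u : K → HyperComplex K) (k : K) : HyperComplex K :=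
  algebraMap ℝ K (1 / √(2 * Real.pi)) • L.starIntegral fun x => u x * L.expI (-(k * x))

end LambdaLimit

/-- `g` is the weak derivative of `u` on `ℝ`. -/
def IsWeakDeriv (u g : ℝ → ℂ) : Prop :=
  ∀ φ : ℝ → ℂ, ContDiff ℝ ∞ φ → HasCompactSupport φ → ∫ x, u x * deriv φ x = -∫ x, g x * φ x

/-- `V^𝔉(ℝ) = H¹(ℝ) ∩ L²(ℝ, |x|²)`, a space of continuous functions (every element of `H¹(ℝ)` is
represented by its continuous representative). -/
def fourierSpace : Submodule ℂ (ℝ → ℂ) where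
  carrier := {u | Continuous u ∧ MemLp u 2 ∧ (∃ g, MemLp g 2 ∧ IsWeakDeriv u g) ∧
    MemLp (fun x : ℝ => (x : ℂ) * u x) 2}
  zero_mem' := ⟨continuous_zero, MemLp.zero, ⟨0, MemLp.zero, fun _ _ _ => by simp⟩, by simp⟩
  add_mem' := by
    rintro u v ⟨hu, hu2, ⟨g, hg, hgu⟩, hux⟩ ⟨hv, hv2, ⟨h, hh, hhv⟩, hvx⟩
    refine ⟨hu.add hv, hu2.add hv2, ⟨g + h, hg.add hh, fun φ hφ hc => ?_⟩, ?_⟩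
    · have h1 : MemLp φ 2 := hφ.continuous.memLp_of_hasCompactSupport hc
      have h2 : MemLp (deriv φ) 2 :=
        (hφ.continuous_deriv (by simp)).memLp_of_hasCompactSupport hc.deriv
      simp only [Pi.add_apply, add_mul]
      have e1 := integral_add (hu2.integrable_mul h2) (hv2.integrable_mul h2)
      have e2 := integral_add (hg.integrable_mul h1) (hh.integrable_mul h1)
      simp only [Pi.mul_apply] at e1 e2
      rw [e1, e2, hgu φ hφ hc, hhv φ hφ hc]
      ring
    · convert hux.add hvx using 1
      funext x
      simp [mul_add]
  smul_mem' := by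
    rintro c u ⟨hu, hu2, ⟨g, hg, hgu⟩, hux⟩
    refine ⟨hu.const_smul c, hu2.const_smul c, ⟨c • g, hg.const_smul c, fun φ hφ hc => ?_⟩, ?_⟩
    · simp only [Pi.smul_apply, smul_eq_mul, mul_assoc, integral_const_mul]
      rw [hgu φ hφ hc]
      ring
    · convert hux.const_smul c using 1
      funext x
      simp [mul_left_comm]

/-- The Fourier transform axiom: the space of ultrafunctions generated by `V^𝔉(ℝ)` is closed under
the Fourier transform and under complex conjugation. -/
def LambdaLimit.FourierTransformAxiom {𝕌 K : Type*} [Field K] [LinearOrder K]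
    [IsStrictOrderedRing K] [Algebra ℝ K] (L : LambdaLimit 𝕌 K) (ι : (ℝ → ℂ) ↪ 𝕌) : Prop :=
  ∀ u ∈ L.ultrafunctions ι fourierSpace,
    L.starFourier u ∈ L.ultrafunctions ι fourierSpace ∧
      (fun x => star (u x)) ∈ L.ultrafunctions ι fourierSpace

open scoped FourierTransform ComplexConjugate

/-! ### The Fourier transform on the line -/

/-! Two `Λ`-limits agree exactly when the nets agree on a set of the filter `qualified`, so the
theorem reduces to a statement about the finite-dimensional spaces V_l for eventually all l. The
Fourier transform axiom descends in the same way: eventually V_l is itself closed under conjugation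
and under the unitary transform F (`FourierTransformAxiom.eventually`).

On such a space W the bilinear form ∫ w v is nondegenerate, because w may be tested against its
conjugate. Hence each functional v ↦ ∫ f v has exactly one representative in W
(`existsUnique_representative`), which gives existence and uniqueness in the limit.

For symmetry, let p and q in W represent e^{iky} and e^{ixy}. Pairing with e^{iky} is √(2π) times
evaluation of F at -k, and FF is reflection. So ∫ p Fq = √(2π) FFq(-k) = √(2π) q(k), and likewise ∫
Fp q = √(2π) p(x). The two integrals are equal because F moves across the pairing
(`representative_exp_symm`). -/

theorem memLp_two_one_add_norm_inv : MemLp (fun x : ℝ => (((1 + ‖x‖)⁻¹ : ℝ) : ℂ)) 2 := by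
  have hc : Continuous fun x : ℝ => (1 + ‖x‖)⁻¹ :=
    (continuous_const.add continuous_norm).inv₀ fun x => (by positivity : (0 : ℝ) < 1 + ‖x‖).ne'
  have h : MemLp (fun x : ℝ => (1 + ‖x‖)⁻¹) 2 := by
    rw [memLp_two_iff_integrable_sq hc.aestronglyMeasurable]
    refine (integrable_one_add_norm (E := ℝ) (r := 2) (by simp)).congr (.of_forall fun x => ?_)
    have : (0 : ℝ) ≤ 1 + ‖x‖ := by positivity
    simp only [Real.rpow_neg this, Real.rpow_ofNat, inv_pow]
  exact h.ofReal

/-- Cauchy–Schwarz applied to |u| = (1+|x|)⁻¹ · (|u| + |x u|), a product of two L² functions. This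
is where the weight |x|² enters. -/
theorem integrable_of_mem_fourierSpace {u : ℝ → ℂ} (hu : u ∈ fourierSpace) : Integrable u := by
  obtain ⟨-, hu2, -, hux⟩ := hu
  have h := memLp_two_one_add_norm_inv.integrable_mul ((hu2.norm.add hux.norm).ofReal (K := ℂ))
  refine h.mono hu2.aestronglyMeasurable (.of_forall fun x => ?_)
  have h0 : (0 : ℝ) < 1 + ‖x‖ := by positivity
  have : (((1 + ‖x‖)⁻¹ : ℝ) : ℂ) * ((‖u x‖ + ‖(x : ℂ) * u x‖ : ℝ) : ℂ) = (‖u x‖ : ℂ) := by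
    rw [← Complex.ofReal_mul, norm_mul, Complex.norm_real]
    congr 1
    field_simp
  simp only [Pi.mul_apply, Pi.add_apply]
  erw [this]
  simp

theorem integrable_mul_of_mem_fourierSpace {u v : ℝ → ℂ} (hu : u ∈ fourierSpace)
    (hv : v ∈ fourierSpace) : Integrable fun x => u x * v x :=
  hu.2.1.integrable_mul hv.2.1

theorem mem_dualMeasurable_fourierSpace_of_bounded {f : ℝ → ℂ} (hf : Continuous f) (C : ℝ)
    (hC : ∀ x, ‖f x‖ ≤ C) : f ∈ LambdaLimit.dualMeasurable fourierSpace :=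
  ⟨hf.aemeasurable, fun _ hv => (integrable_of_mem_fourierSpace hv).bdd_mul
    hf.aestronglyMeasurable (.of_forall hC)⟩

theorem mem_dualMeasurable_of_mem_fourierSpace {f : ℝ → ℂ} (hf : f ∈ fourierSpace) :
    f ∈ LambdaLimit.dualMeasurable fourierSpace :=
  ⟨hf.1.aemeasurable, fun _ hv => integrable_mul_of_mem_fourierSpace hf hv⟩

theorem norm_exp_I_mul_ofReal (t : ℝ) : ‖Complex.exp (Complex.I * t)‖ = 1 := by
  rw [mul_comm, Complex.norm_exp_ofReal_mul_I]

theorem exp_mem_dualMeasurable_fourierSpace (k : ℝ) :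
    (fun x : ℝ => Complex.exp (Complex.I * ((k * x : ℝ) : ℂ))) ∈
      LambdaLimit.dualMeasurable fourierSpace :=
  mem_dualMeasurable_fourierSpace_of_bounded (by fun_prop) 1
    fun x => (norm_exp_I_mul_ofReal (k * x)).le

/-- The unitary Fourier transform `k ↦ (2π)^{-1/2} ∫ f(x) e^{-ikx} dx`. -/
noncomputable def fourierUnitary (f : ℝ → ℂ) (k : ℝ) : ℂ :=
  ((1 / √(2 * Real.pi) : ℝ) : ℂ) *
    ∫ x, f x * Complex.exp (Complex.I * ((-(k * x) : ℝ) : ℂ))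

theorem fourierUnitary_eq (f : ℝ → ℂ) (k : ℝ) :
    fourierUnitary f k = ((1 / √(2 * Real.pi) : ℝ) : ℂ) * 𝓕 f (k / (2 * Real.pi)) := by
  rw [fourierUnitary, Real.fourier_real_eq_integral_exp_smul]
  congr 2
  funext x
  rw [smul_eq_mul, mul_comm, mul_comm Complex.I]
  congr 4
  field_simp

theorem integral_exp_mul_eq_fourierUnitary (f : ℝ → ℂ) (k : ℝ) :
    ∫ x, Complex.exp (Complex.I * ((k * x : ℝ) : ℂ)) * f x =
      ((√(2 * Real.pi) : ℝ) : ℂ) * fourierUnitary f (-k) := by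
  have h : √(2 * Real.pi) ≠ 0 := by positivity
  rw [fourierUnitary, ← mul_assoc, ← Complex.ofReal_mul, mul_one_div_cancel h, Complex.ofReal_one,
    one_mul]
  simp only [neg_mul, neg_neg]
  congr 1
  funext x
  rw [mul_comm]

/-- Fourier inversion after the substitution k = 2πs; the two factors (2π)^{-1/2} cancel the
Jacobian 2π. Integrability of the transform will come from closure of W under F. -/
theorem fourierUnitary_fourierUnitary {f : ℝ → ℂ} (hc : Continuous f) (hf : Integrable f)
    (hf' : Integrable (fourierUnitary f)) (x : ℝ) :
    fourierUnitary (fourierUnitary f) x = f (-x) := by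
  have h2 : (2 * Real.pi) ≠ 0 := by positivity
  have hs : √(2 * Real.pi) ≠ 0 := by positivity
  have hF : Integrable (𝓕 f) := by
    have h := (hf'.comp_mul_right' h2).const_mul ((√(2 * Real.pi) : ℝ) : ℂ)
    refine h.congr (.of_forall fun k => ?_)
    simp only [fourierUnitary_eq]
    rw [← mul_assoc, ← Complex.ofReal_mul, mul_one_div_cancel hs, Complex.ofReal_one, one_mul,
      mul_div_cancel_right₀ _ h2]
  have hinv := hf.fourierInv_fourier_eq hF (hc.continuousAt (x := -x))
  rw [Real.fourierInv_eq_fourier_neg, neg_neg, Real.fourier_real_eq_integral_exp_smul] at hinv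
  rw [fourierUnitary]
  have h := Measure.integral_comp_div
    (fun s : ℝ => Complex.exp (↑(-2 * Real.pi * s * x) * Complex.I) • 𝓕 f s) (2 * Real.pi)
  rw [hinv, abs_of_pos (by positivity)] at h
  have h3 : ∀ y : ℝ, fourierUnitary f y * Complex.exp (Complex.I * ((-(x * y) : ℝ) : ℂ)) =
      ((1 / √(2 * Real.pi) : ℝ) : ℂ) *
        (Complex.exp (↑(-2 * Real.pi * (y / (2 * Real.pi)) * x) * Complex.I) •
          𝓕 f (y / (2 * Real.pi))) := by
    intro y
    have : -2 * Real.pi * (y / (2 * Real.pi)) * x = -(x * y) := by field_simp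
    rw [fourierUnitary_eq, this, smul_eq_mul, mul_comm Complex.I]
    ring
  simp only [h3]
  rw [integral_const_mul, h, ← mul_assoc, ← Complex.ofReal_mul, Complex.real_smul, ← mul_assoc,
    ← Complex.ofReal_mul]
  have : 1 / √(2 * Real.pi) * (1 / √(2 * Real.pi)) * (2 * Real.pi) = 1 := by
    rw [one_div_mul_one_div, Real.mul_self_sqrt (by positivity), one_div_mul_cancel h2]
  rw [this, Complex.ofReal_one, one_mul]

theorem integral_fourierUnitary_mul {f g : ℝ → ℂ} (hf : Integrable f) (hg : Integrable g) :
    ∫ k, fourierUnitary f k * g k = ∫ x, f x * fourierUnitary g x := by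
  -- The factor (2π)⁻¹ turns the character e^{-2πi B(x,k)} into e^{-ikx}; B is symmetric, so the
  -- flipped transform is the same one.
  let B : ℝ →ₗ[ℝ] ℝ →ₗ[ℝ] ℝ := (2 * Real.pi)⁻¹ • LinearMap.mul ℝ ℝ
  have hB : ∀ x y, B x y = (2 * Real.pi)⁻¹ * (x * y) := fun x y => rfl
  have hflip : B.flip = B := by ext; simp [hB]
  have key : ∀ (h : ℝ → ℂ) (k : ℝ), fourierUnitary h k =
      ((1 / √(2 * Real.pi) : ℝ) : ℂ) * VectorFourier.fourierIntegral 𝐞 volume B h k := by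
    intro h k
    rw [fourierUnitary, VectorFourier.fourierIntegral]
    congr 2
    funext x
    rw [Circle.smul_def, Real.fourierChar_apply, smul_eq_mul, mul_comm, mul_comm Complex.I, hB]
    congr 4
    field_simp
  have h := VectorFourier.integral_fourierIntegral_smul_eq_flip (L := B) (μ := volume)
    (ν := volume) Real.continuous_fourierChar (by simp only [hB]; fun_prop) hf hg
  rw [hflip] at h
  simp only [key, mul_assoc, mul_left_comm (f _), integral_const_mul]
  simp only [smul_eq_mul] at h
  rw [h]

/-! ### Finite-dimensional spaces closed under conjugation and Fourier transform -/

/-- The bilinear pairing `w ↦ (v ↦ ∫ w v)` on a space of functions in `V^𝔉(ℝ)`. -/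
noncomputable def integralPairing (W : Submodule ℂ (ℝ → ℂ)) (hW : W ≤ fourierSpace) :
    W →ₗ[ℂ] Module.Dual ℂ W :=
  LinearMap.mk₂ ℂ (fun w v => ∫ x, w.1 x * v.1 x)
    (fun w w' v => by
      rw [← integral_add (integrable_mul_of_mem_fourierSpace (hW w.2) (hW v.2))
        (integrable_mul_of_mem_fourierSpace (hW w'.2) (hW v.2))]
      simp [add_mul])
    (fun c w v => by simp [mul_assoc, integral_const_mul])
    (fun w v v' => by
      rw [← integral_add (integrable_mul_of_mem_fourierSpace (hW w.2) (hW v.2))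
        (integrable_mul_of_mem_fourierSpace (hW w.2) (hW v'.2))]
      simp [mul_add])
    (fun c w v => by simp [mul_left_comm, integral_const_mul])

/-- Testing w against its conjugate gives ∫ |w|² = 0, and continuity upgrades vanishing almost
everywhere to vanishing. -/
theorem integralPairing_injective {W : Submodule ℂ (ℝ → ℂ)} (hW : W ≤ fourierSpace)
    (hconj : ∀ w ∈ W, (fun x => conj (w x)) ∈ W) :
    Function.Injective (integralPairing W hW) := by
  rw [injective_iff_map_eq_zero]
  intro w hw
  have h := LinearMap.congr_fun hw ⟨_, hconj w.1 w.2⟩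
  have h0 : ∫ x, w.1 x * conj (w.1 x) = 0 := h
  have hint := integrable_mul_of_mem_fourierSpace (hW w.2) (hW (hconj w.1 w.2))
  have e : ∀ x, w.1 x * conj (w.1 x) = ((Complex.normSq (w.1 x) : ℝ) : ℂ) :=
    fun x => Complex.mul_conj _
  simp only [e] at h0 hint
  rw [integral_complex_ofReal, Complex.ofReal_eq_zero] at h0
  have hint' : Integrable fun x => Complex.normSq (w.1 x) := by simpa using hint.re
  rw [integral_eq_zero_iff_of_nonneg (fun x => Complex.normSq_nonneg _) hint'] at h0
  have hc : Continuous fun x => Complex.normSq (w.1 x) :=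
    Complex.continuous_normSq.comp (hW w.2).1
  have h1 := (Continuous.ae_eq_iff_eq volume hc continuous_const).1 h0
  ext x
  exact Complex.normSq_eq_zero.1 (congrFun h1 x)

/-- Every functional defined by a function `f` with `f v` integrable for `v ∈ V^𝔉(ℝ)` has a unique
representative in a finite-dimensional conjugation-invariant subspace. -/
theorem existsUnique_representative {W : Submodule ℂ (ℝ → ℂ)} [FiniteDimensional ℂ W]
    (hW : W ≤ fourierSpace) (hconj : ∀ w ∈ W, (fun x => conj (w x)) ∈ W) {f : ℝ → ℂ}
    (hf : f ∈ LambdaLimit.dualMeasurable fourierSpace) :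
    ∃! p, p ∈ W ∧ ∀ v ∈ W, ∫ x, f x * v x = ∫ x, p x * v x := by
  have hinj := integralPairing_injective hW hconj
  let φ : Module.Dual ℂ W :=
    { toFun := fun v => ∫ x, f x * v.1 x
      map_add' := fun v v' => by
        rw [← integral_add (hf.2 _ (hW v.2)) (hf.2 _ (hW v'.2))]
        simp [mul_add]
      map_smul' := fun c v => by simp [mul_left_comm, integral_const_mul] }
  have hsurj : Function.Surjective (integralPairing W hW) :=
    (LinearMap.injective_iff_surjective_of_finrank_eq_finrank
      Subspace.dual_finrank_eq.symm).1 hinj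
  obtain ⟨p, hp⟩ := hsurj φ
  refine ⟨p.1, ⟨p.2, fun v hv => (LinearMap.congr_fun hp ⟨v, hv⟩).symm⟩, ?_⟩
  rintro q ⟨hq, hq'⟩
  have : (⟨q, hq⟩ : W) = p := hinj <| by
    rw [hp]
    exact LinearMap.ext fun v => (hq' v.1 v.2).symm
  rw [← this]

/-- The representatives of the exponentials in a space closed under the Fourier transform are
symmetric in frequency and position. -/
theorem representative_exp_symm {W : Submodule ℂ (ℝ → ℂ)} (hW : W ≤ fourierSpace)
    (hF : ∀ w ∈ W, fourierUnitary w ∈ W) {p q : ℝ → ℂ} {k x : ℝ} (hp : p ∈ W) (hq : q ∈ W)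
    (hpk : ∀ v ∈ W,
      ∫ y, Complex.exp (Complex.I * ((k * y : ℝ) : ℂ)) * v y = ∫ y, p y * v y)
    (hqx : ∀ v ∈ W,
      ∫ y, Complex.exp (Complex.I * ((x * y : ℝ) : ℂ)) * v y = ∫ y, q y * v y) :
    p x = q k := by
  have hs : ((√(2 * Real.pi) : ℝ) : ℂ) ≠ 0 := Complex.ofReal_ne_zero.2 (by positivity)
  have hFF : ∀ w ∈ W, ∀ y, fourierUnitary (fourierUnitary w) (-y) = w y := fun w hw y => by
    rw [fourierUnitary_fourierUnitary (hW hw).1 (integrable_of_mem_fourierSpace (hW hw))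
      (integrable_of_mem_fourierSpace (hW (hF w hw))), neg_neg]
  have h := integral_fourierUnitary_mul (integrable_of_mem_fourierSpace (hW hp))
    (integrable_of_mem_fourierSpace (hW hq))
  -- Fq lies in W, so p may be replaced by the exponential it represents; the same is then done for
  -- q against Fp.
  rw [← hpk _ (hF q hq), integral_exp_mul_eq_fourierUnitary, hFF q hq] at h
  simp only [mul_comm _ (q _)] at h
  rw [← hqx _ (hF p hp), integral_exp_mul_eq_fourierUnitary, hFF p hp] at h
  exact mul_left_cancel₀ hs (h.trans (mul_comm _ _))

/-! ### Transfer between nets and their `Λ`-limits -/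

namespace LambdaLimit

variable {𝕌 K : Type*} [Field K] [LinearOrder K] [IsStrictOrderedRing K] [Algebra ℝ K]
  (L : LambdaLimit 𝕌 K)

theorem lim_const (r : ℝ) : L.lim (fun _ => r) = algebraMap ℝ K r :=
  L.lim_of_eventually_const _ ∅ r fun _ _ => rfl

theorem lim_neg (φ : Finset 𝕌 → ℝ) : L.lim (fun l => -φ l) = -L.lim φ := by
  simpa [L.lim_zero] using L.lim_sub (fun _ => 0) φ

/-- The filter of the sets that contain the zero set of an infinitesimally vanishing net: a property
holds eventually along it iff it is visible in the `Λ`-limit. -/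
def qualified : Filter (Finset 𝕌) where
  sets := {s | ∃ d : Finset 𝕌 → ℝ, L.lim d = 0 ∧ ∀ l, d l = 0 → l ∈ s}
  univ_sets := ⟨fun _ => 0, L.lim_zero, fun _ _ => trivial⟩
  sets_of_superset := fun ⟨d, hd, h⟩ hst => ⟨d, hd, fun l hl => hst (h l hl)⟩
  inter_sets := fun {s t} ⟨d, hd, h⟩ ⟨d', hd', h'⟩ => by
    -- A sum of squares vanishes exactly where both nets vanish.
    refine ⟨fun l => d l * d l + d' l * d' l, ?_, fun l hl => ?_⟩
    · rw [← L.lim_add, ← L.lim_mul, ← L.lim_mul, hd, hd']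
      simp
    · have h2 := (add_eq_zero_iff_of_nonneg (mul_self_nonneg _) (mul_self_nonneg _)).1 hl
      exact ⟨h l (mul_self_eq_zero.1 h2.1), h' l (mul_self_eq_zero.1 h2.2)⟩

theorem eventually_qualified_iff {p : Finset 𝕌 → Prop} :
    (∀ᶠ l in L.qualified, p l) ↔ ∃ d : Finset 𝕌 → ℝ, L.lim d = 0 ∧ ∀ l, d l = 0 → p l :=
  Iff.rfl

theorem limC_congr {a b : Finset 𝕌 → ℂ} (h : ∀ᶠ l in L.qualified, a l = b l) :
    L.limC a = L.limC b := by
  obtain ⟨d, hd, hd'⟩ := L.eventually_qualified_iff.1 h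
  exact L.limC_congr_of_zero hd hd'

theorem eventually_eq_of_limFun_eq {f g : Finset 𝕌 → ℝ → ℂ} (h : L.limFun f = L.limFun g) :
    ∀ᶠ l in L.qualified, f l = g l :=
  L.exists_zero_of_limFun_eq h

theorem limFun_congr {f g : Finset 𝕌 → ℝ → ℂ} (h : ∀ᶠ l in L.qualified, f l = g l) :
    L.limFun f = L.limFun g :=
  funext fun _ => L.limC_congr (h.mono fun l hl => by rw [hl])

theorem eventually_eq_of_limC_eq {a b : Finset 𝕌 → ℂ} (h : L.limC a = L.limC b) :
    ∀ᶠ l in L.qualified, a l = b l :=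
  (L.eventually_eq_of_limFun_eq (f := fun l _ => a l) (g := fun l _ => b l)
    (funext fun _ => h)).mono fun _ hl => congrFun hl 0

theorem limC_mul (a b : Finset 𝕌 → ℂ) : L.limC a * L.limC b = L.limC fun l => a l * b l := by
  ext <;> simp only [limC, QuadraticAlgebra.re_mul, QuadraticAlgebra.im_mul, L.lim_mul,
    Complex.mul_re, Complex.mul_im]
  · rw [L.lim_sub, neg_one_mul, neg_mul, L.lim_mul, ← sub_eq_add_neg]
  · rw [zero_mul, zero_mul, add_zero, L.lim_add]

theorem star_limC (a : Finset 𝕌 → ℂ) : star (L.limC a) = L.limC fun l => conj (a l) := by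
  ext <;> simp [limC, L.lim_neg]

theorem algebraMap_smul_limC (r : ℝ) (a : Finset 𝕌 → ℂ) :
    algebraMap ℝ K r • L.limC a = L.limC fun l => (r : ℂ) * a l := by
  ext <;> simp only [limC, QuadraticAlgebra.re_smul, QuadraticAlgebra.im_smul, smul_eq_mul,
    Complex.re_ofReal_mul, Complex.im_ofReal_mul, ← L.lim_mul, L.lim_const]

theorem limFun_mul (f g : Finset 𝕌 → ℝ → ℂ) :
    (fun x => L.limFun f x * L.limFun g x) = L.limFun fun l t => f l t * g l t :=
  funext fun _ => L.limC_mul _ _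

theorem star_limFun (f : Finset 𝕌 → ℝ → ℂ) :
    (fun x => star (L.limFun f x)) = L.limFun fun l t => conj (f l t) :=
  funext fun _ => L.star_limC _

theorem expI_lim (t : Finset 𝕌 → ℝ) :
    L.expI (L.lim t) = L.limC fun l => Complex.exp (Complex.I * t l) :=
  L.limFun_lim (fun _ s => Complex.exp (Complex.I * s)) t

theorem expI_mul_eq_limFun (k : Finset 𝕌 → ℝ) :
    (fun x => L.expI (L.lim k * x)) =
      L.limFun fun l t => Complex.exp (Complex.I * ((k l * t : ℝ) : ℂ)) := by
  funext x
  obtain ⟨y, rfl⟩ := L.surj x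
  rw [L.lim_mul, L.expI_lim, L.limFun_lim]

theorem starFourier_limFun (f : Finset 𝕌 → ℝ → ℂ) (hf : ∀ l, Integrable (f l)) :
    L.starFourier (L.limFun f) = L.limFun fun l => fourierUnitary (f l) := by
  funext k
  obtain ⟨κ, rfl⟩ := L.surj k
  have h := L.expI_mul_eq_limFun fun l => -κ l
  simp only [L.lim_neg, neg_mul] at h
  have h' : (fun x => L.limFun f x * L.expI (-(L.lim κ * x))) = L.limFun fun l t =>
      f l t * Complex.exp (Complex.I * ((-(κ l * t) : ℝ) : ℂ)) := by
    rw [← L.limFun_mul, ← h]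
  rw [starFourier, h', L.starIntegral_limFun, L.algebraMap_smul_limC, L.limFun_lim]
  · rfl
  · intro l
    exact (hf l).mul_bdd (c := 1) (by fun_prop)
      (.of_forall fun x => (norm_exp_I_mul_ofReal _).le)

/-- If every net of elements of `S l` is eventually mapped into `S l`, then eventually all of `S l`
is. -/
theorem eventually_forall_mem {S : Finset 𝕌 → Set (ℝ → ℂ)} (hS : ∀ l, (S l).Nonempty)
    {P : Finset 𝕌 → (ℝ → ℂ) → Prop}
    (h : ∀ f : Finset 𝕌 → ℝ → ℂ, (∀ l, f l ∈ S l) → ∀ᶠ l in L.qualified, P l (f l)) :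
    ∀ᶠ l in L.qualified, ∀ f ∈ S l, P l f := by
  -- Choose a counterexample to P at l whenever one exists: if P holds for this chosen element, it
  -- holds on all of S l.
  have : ∀ l, ∃ f ∈ S l, P l f → ∀ g ∈ S l, P l g := by
    intro l
    by_cases hl : ∀ g ∈ S l, P l g
    · obtain ⟨f, hf⟩ := hS l
      exact ⟨f, hf, fun _ => hl⟩
    · push Not at hl
      obtain ⟨g, hg, hg'⟩ := hl
      exact ⟨g, hg, fun hP => absurd hP hg'⟩
  choose f hf hf' using this
  exact (h f hf).mono hf'

/-! ### Ultrafunctions as limits of the spaces V_l, and canonical extensions -/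

variable (ι : (ℝ → ℂ) ↪ 𝕌)

/-- The finite-dimensional space `V_l = Span (V ∩ l)`. -/
def approxSpace (V : Submodule ℂ (ℝ → ℂ)) (l : Finset 𝕌) : Submodule ℂ (ℝ → ℂ) :=
  Submodule.span ℂ {v | v ∈ V ∧ ι v ∈ l}

theorem approxSpace_le (V : Submodule ℂ (ℝ → ℂ)) (l : Finset 𝕌) : approxSpace ι V l ≤ V :=
  Submodule.span_le.2 fun _ hv => hv.1

instance (V : Submodule ℂ (ℝ → ℂ)) (l : Finset 𝕌) : FiniteDimensional ℂ (approxSpace ι V l) :=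
  FiniteDimensional.span_of_finite ℂ <|
    (l.finite_toSet.preimage ι.injective.injOn).subset fun _ hv => hv.2

variable {L ι}

theorem mem_ultrafunctions_iff {V : Submodule ℂ (ℝ → ℂ)} {w : K → HyperComplex K} :
    w ∈ L.ultrafunctions ι V ↔
      ∃ f : Finset 𝕌 → ℝ → ℂ, (∀ l, f l ∈ approxSpace ι V l) ∧ L.limFun f = w :=
  Iff.rfl

/-- Were closure not eventual, a net of counterexamples would have a limit violating the axiom;
`eventually_forall_mem` makes this precise. -/
theorem FourierTransformAxiom.eventually (hFTA : L.FourierTransformAxiom ι) :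
    ∀ᶠ l in L.qualified, (∀ w ∈ approxSpace ι fourierSpace l,
      fourierUnitary w ∈ approxSpace ι fourierSpace l) ∧
      ∀ w ∈ approxSpace ι fourierSpace l, (fun x => conj (w x)) ∈ approxSpace ι fourierSpace l := by
  refine Filter.Eventually.and ?_ ?_
  · refine L.eventually_forall_mem (S := fun l => approxSpace ι fourierSpace l)
      (fun l => ⟨0, zero_mem _⟩) fun f hf => ?_
    obtain ⟨g, hg, hgf⟩ := mem_ultrafunctions_iff.1 (hFTA _ ⟨f, hf, rfl⟩).1
    rw [L.starFourier_limFun f fun l =>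
      integrable_of_mem_fourierSpace (approxSpace_le ι _ l (hf l))] at hgf
    exact (L.eventually_eq_of_limFun_eq hgf).mono fun l hl => hl ▸ hg l
  · refine L.eventually_forall_mem (S := fun l => approxSpace ι fourierSpace l)
      (fun l => ⟨0, zero_mem _⟩) fun f hf => ?_
    obtain ⟨g, hg, hgf⟩ := mem_ultrafunctions_iff.1 (hFTA _ ⟨f, hf, rfl⟩).2
    rw [L.star_limFun] at hgf
    exact (L.eventually_eq_of_limFun_eq hgf).mono fun l hl => hl ▸ hg l

/-- The limit of functions `p l ∈ V_l` is a canonical extension of `lim f l` iff eventually `p l`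
represents `f l` on `V_l`. -/
theorem isCanonicalExtension_limFun_iff {V : Submodule ℂ (ℝ → ℂ)}
    (hV : ∀ v ∈ V, v ∈ dualMeasurable V) {f p : Finset 𝕌 → ℝ → ℂ} (hf : ∀ l, f l ∈ dualMeasurable V)
    (hp : ∀ l, p l ∈ approxSpace ι V l) :
    L.IsCanonicalExtension ι V (L.limFun f) (L.limFun p) ↔
      ∀ᶠ l in L.qualified, ∀ v ∈ approxSpace ι V l, ∫ x, f l x * v x = ∫ x, p l x * v x := by
  have key : ∀ v : Finset 𝕌 → ℝ → ℂ, (∀ l, v l ∈ approxSpace ι V l) →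
      (L.starIntegral (fun x => L.limFun f x * L.limFun v x) =
        L.limC fun l => ∫ x, f l x * v l x) ∧
      (L.starIntegral (fun x => L.limFun p x * L.limFun v x) =
        L.limC fun l => ∫ x, p l x * v l x) := by
    intro v hv
    have hvV := fun l => approxSpace_le ι V l (hv l)
    rw [L.limFun_mul, L.limFun_mul, L.starIntegral_limFun _ fun l => (hf l).2 _ (hvV l),
      L.starIntegral_limFun _ fun l => (hV _ (approxSpace_le ι V l (hp l))).2 _ (hvV l)]
    exact ⟨rfl, rfl⟩
  constructor
  · rintro ⟨-, -, h⟩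
    refine L.eventually_forall_mem (S := fun l => approxSpace ι V l)
      (P := fun l v => ∫ x, f l x * v x = ∫ x, p l x * v x)
      (fun l => ⟨0, zero_mem _⟩) fun v hv => ?_
    have h1 := h _ ⟨v, hv, rfl⟩
    rw [(key v hv).1, (key v hv).2] at h1
    exact L.eventually_eq_of_limC_eq h1
  · intro h
    refine ⟨⟨f, hf, rfl⟩, ⟨p, hp, rfl⟩, ?_⟩
    rintro _ ⟨v, hv, rfl⟩
    rw [(key v hv).1, (key v hv).2]
    exact L.limC_congr (h.mono fun l hl => hl _ (hv l))

theorem canonicalExtension_spec {V : Submodule ℂ (ℝ → ℂ)} {u : K → HyperComplex K}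
    (h : ∃ w, L.IsCanonicalExtension ι V u w) :
    L.IsCanonicalExtension ι V u (L.canonicalExtension ι V u) := by
  rw [canonicalExtension, dif_pos h]
  exact h.choose_spec

theorem FourierTransformAxiom.existsUnique_isCanonicalExtension
    (hFTA : L.FourierTransformAxiom ι) {u : K → HyperComplex K}
    (hu : u ∈ L.starSet (dualMeasurable fourierSpace)) :
    ∃! w, L.IsCanonicalExtension ι fourierSpace u w := by
  classical
  obtain ⟨f, hf, rfl⟩ := hu
  have hV : ∀ v ∈ fourierSpace, v ∈ dualMeasurable fourierSpace :=
    fun v hv => mem_dualMeasurable_of_mem_fourierSpace hv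
  -- A net needs an element of V_l at every l, so 0 serves as the default where V_l is not closed
  -- under conjugation.
  have hex : ∀ l, ∃ p ∈ approxSpace ι fourierSpace l,
      (∀ w ∈ approxSpace ι fourierSpace l, (fun x => conj (w x)) ∈ approxSpace ι fourierSpace l) →
      ∀ v ∈ approxSpace ι fourierSpace l, ∫ x, f l x * v x = ∫ x, p x * v x := by
    intro l
    by_cases hl : ∀ w ∈ approxSpace ι fourierSpace l,
      (fun x => conj (w x)) ∈ approxSpace ι fourierSpace l
    · obtain ⟨p, ⟨hp, hp'⟩, -⟩ := existsUnique_representative (approxSpace_le ι _ l) hl (hf l)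
      exact ⟨p, hp, fun _ => hp'⟩
    · exact ⟨0, zero_mem _, fun h => absurd h hl⟩
  choose p hp hp' using hex
  have hpe := hFTA.eventually.mono fun l hl => hp' l hl.2
  refine ⟨L.limFun p, (isCanonicalExtension_limFun_iff hV hf hp).2 hpe, fun w hw => ?_⟩
  obtain ⟨q, hq, rfl⟩ := mem_ultrafunctions_iff.1 hw.2.1
  have hqe := (isCanonicalExtension_limFun_iff hV hf hq).1 hw
  refine L.limFun_congr ?_
  filter_upwards [hFTA.eventually, hpe, hqe] with l hl hpl hql
  exact (existsUnique_representative (approxSpace_le ι _ l) hl.2 (hf l)).unique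
    ⟨hq l, hql⟩ ⟨hp l, hpl⟩

theorem expI_mul_mem_starSet (k : K) :
    (fun x => L.expI (k * x)) ∈ L.starSet (dualMeasurable fourierSpace) := by
  obtain ⟨κ, rfl⟩ := L.surj k
  exact ⟨_, fun l => exp_mem_dualMeasurable_fourierSpace (κ l), (L.expI_mul_eq_limFun κ).symm⟩

theorem FourierTransformAxiom.canonicalExtension_expI_symm (hFTA : L.FourierTransformAxiom ι)
    (k x : K) :
    L.canonicalExtension ι fourierSpace (fun ξ => L.expI (k * ξ)) x =
      L.canonicalExtension ι fourierSpace (fun ξ => L.expI (x * ξ)) k := by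
  have hV : ∀ v ∈ fourierSpace, v ∈ dualMeasurable fourierSpace :=
    fun v hv => mem_dualMeasurable_of_mem_fourierSpace hv
  have hspec : ∀ k : K, L.IsCanonicalExtension ι fourierSpace (fun ξ => L.expI (k * ξ))
      (L.canonicalExtension ι fourierSpace fun ξ => L.expI (k * ξ)) := fun k =>
    canonicalExtension_spec
      (hFTA.existsUnique_isCanonicalExtension (expI_mul_mem_starSet k)).exists
  -- The frequency varies with l: along a net κ with limit k, the canonical extension comes from the
  -- representatives of e^{iκ_l y} in V_l.
  have hrep : ∀ κ : Finset 𝕌 → ℝ, ∃ p : Finset 𝕌 → ℝ → ℂ,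
      (∀ l, p l ∈ approxSpace ι fourierSpace l) ∧
      L.limFun p = L.canonicalExtension ι fourierSpace (fun ξ => L.expI (L.lim κ * ξ)) ∧
      ∀ᶠ l in L.qualified, ∀ v ∈ approxSpace ι fourierSpace l,
        ∫ y, Complex.exp (Complex.I * ((κ l * y : ℝ) : ℂ)) * v y = ∫ y, p l y * v y := by
    intro κ
    have h := hspec (L.lim κ)
    obtain ⟨p, hp, hpe⟩ := mem_ultrafunctions_iff.1 h.2.1
    refine ⟨p, hp, hpe, ?_⟩
    rw [← hpe, L.expI_mul_eq_limFun] at h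
    exact (isCanonicalExtension_limFun_iff hV
      (fun l => exp_mem_dualMeasurable_fourierSpace (κ l)) hp).1 h
  obtain ⟨κ, rfl⟩ := L.surj k
  obtain ⟨ξ, rfl⟩ := L.surj x
  obtain ⟨p, hp, hpe, hpκ⟩ := hrep κ
  obtain ⟨q, hq, hqe, hqξ⟩ := hrep ξ
  rw [← hpe, ← hqe, L.limFun_lim, L.limFun_lim]
  refine L.limC_congr ?_
  filter_upwards [hFTA.eventually, hpκ, hqξ] with l hl hpl hql
  exact representative_exp_symm (approxSpace_le ι _ l) hl.1 (hp l) (hq l) hpl hql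

end LambdaLimit

theorem mainTheorem12 {𝕌 K : Type*} [Field K] [LinearOrder K] [IsStrictOrderedRing K] [Algebra ℝ K]
    (L : LambdaLimit 𝕌 K) (ι : (ℝ → ℂ) ↪ 𝕌) (hFTA : L.FourierTransformAxiom ι) :
    (∀ k : K, ∃! w, L.IsCanonicalExtension ι fourierSpace (fun x => L.expI (k * x)) w) ∧
    (∀ x : K, ∃! w, L.IsCanonicalExtension ι fourierSpace (fun k => L.expI (k * x)) w) ∧
    ∀ k x : K,
      L.canonicalExtension ι fourierSpace (fun ξ => L.expI (k * ξ)) x =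
        L.canonicalExtension ι fourierSpace (fun κ => L.expI (κ * x)) k := by
  refine ⟨fun k => hFTA.existsUnique_isCanonicalExtension (LambdaLimit.expI_mul_mem_starSet k),
    fun x => ?_, fun k x => ?_⟩
  · simp only [mul_comm _ x]
    exact hFTA.existsUnique_isCanonicalExtension (LambdaLimit.expI_mul_mem_starSet x)
  · simp only [mul_comm _ x]
    exact hFTA.canonicalExtension_expI_symm k x
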